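/- Let $k$ be a noetherian commutative ring and let $G$ be a finite flat group scheme over $k$; that is, $G=\operatorname{Spec} k[G]$ for a commutative Hopf algebra $k[G]$ over $k$ which is finitely generated and flat (equivalently, finitely generated projective) as a $k$-module. A $G$-module is a $k$-module $M$ (not necessarily finitely generated) with a linear action of $G$, i.e. a $k[G]$-comodule $\rho_M:M\to M\otimes_k k[G]$; its module of invariants is $M^G=\{m\in M : \rho_M(m)=m\otimes 1\}$, and $H^i(G,-)$ denotes the $i$-th right derived functor of $M\mapsto M^G$ on the (abelian) category of $G$-modules. Then there is a positive integer $n$ such that $n\cdot H^i(G,M)=0$ for all $i>0$ and all $G$-modules $M$. -/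

import Mathlib

open CategoryTheory CategoryTheory.Limits
open scoped TensorProduct

universe u

noncomputable section

/-- A `G`-module (rational representation) for the affine group scheme `G = Spec A` over `k`, where
`A = k[G]` is the coordinate Hopf algebra: a `k`-module `V` with a coaction `V → V ⊗ k[G]` that is
coassociative and counital, i.e. a right `k[G]`-comodule. No finiteness is imposed on `V`. -/
structure GModule (k : Type u) [CommRing k] (A : Type u) [CommRing A] [HopfAlgebra k A] where
  /-- The underlying type. -/
  V : Type u
  [addCommGroup : AddCommGroup V]
  [module : Module k V]
  /-- The coaction. -/
  coact : V →ₗ[k] V ⊗[k] A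
  coassoc : (TensorProduct.assoc k V A A).toLinearMap ∘ₗ coact.rTensor A ∘ₗ coact =
    (Coalgebra.comul (R := k) (A := A)).lTensor V ∘ₗ coact
  counit : (TensorProduct.rid k V).toLinearMap ∘ₗ
    (Coalgebra.counit (R := k) (A := A)).lTensor V ∘ₗ coact = LinearMap.id

namespace GModule

variable {k : Type u} [CommRing k] {A : Type u} [CommRing A] [HopfAlgebra k A]

attribute [instance] addCommGroup module

/-- A morphism of `G`-modules: a `k`-linear map compatible with the coactions. -/
@[ext]
structure Hom (M N : GModule k A) where
  /-- The underlying linear map. -/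
  toLin : M.V →ₗ[k] N.V
  comm : N.coact ∘ₗ toLin = toLin.rTensor A ∘ₗ M.coact

instance : Category (GModule k A) where
  Hom M N := Hom M N
  id M := ⟨LinearMap.id, by simp⟩
  comp f g := ⟨g.toLin ∘ₗ f.toLin, by
    rw [← LinearMap.comp_assoc, g.comm, LinearMap.comp_assoc, f.comm, LinearMap.rTensor_comp,
      LinearMap.comp_assoc]⟩

variable {M N P : GModule k A}

/-- The linear map underlying a morphism of `G`-modules. -/
def lin (f : M ⟶ N) : M.V →ₗ[k] N.V := Hom.toLin f

/-- Construct a morphism of `G`-modules. -/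
def homMk (f : M.V →ₗ[k] N.V) (h : N.coact ∘ₗ f = f.rTensor A ∘ₗ M.coact) : M ⟶ N := Hom.mk f h

theorem comm (f : M ⟶ N) : N.coact ∘ₗ lin f = (lin f).rTensor A ∘ₗ M.coact := Hom.comm f

theorem comm_apply (f : M ⟶ N) (x : M.V) : N.coact (lin f x) = (lin f).rTensor A (M.coact x) :=
  LinearMap.congr_fun (comm f) x

@[ext]
theorem hom_ext {f g : M ⟶ N} (h : lin f = lin g) : f = g := Hom.ext h

theorem lin_injective : Function.Injective (lin : (M ⟶ N) → (M.V →ₗ[k] N.V)) :=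
  fun _ _ h => hom_ext h

@[simp] theorem homMk_lin (f : M.V →ₗ[k] N.V) (h) : lin (homMk f h : M ⟶ N) = f := rfl

@[simp] theorem id_lin : lin (𝟙 M) = LinearMap.id := rfl

@[simp] theorem comp_lin (f : M ⟶ N) (g : N ⟶ P) : lin (f ≫ g) = lin g ∘ₗ lin f := rfl

instance : Zero (M ⟶ N) := ⟨homMk 0 (by simp)⟩

instance : Add (M ⟶ N) := ⟨fun f g => homMk (lin f + lin g) (by
  rw [LinearMap.comp_add, LinearMap.rTensor_add, LinearMap.add_comp, comm f, comm g])⟩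

instance : Neg (M ⟶ N) := ⟨fun f => homMk (-lin f) (by
  rw [LinearMap.comp_neg, LinearMap.rTensor_neg, LinearMap.neg_comp, comm f])⟩

instance : Sub (M ⟶ N) := ⟨fun f g => homMk (lin f - lin g) (by
  rw [LinearMap.comp_sub, LinearMap.rTensor_sub, LinearMap.sub_comp, comm f, comm g])⟩

instance : SMul ℕ (M ⟶ N) := ⟨fun n f => homMk (n • lin f) (by
  ext x; simp [comm_apply, LinearMap.rTensor, TensorProduct.map_smul_left,
    ← Nat.cast_smul_eq_nsmul k])⟩

instance : SMul ℤ (M ⟶ N) := ⟨fun n f => homMk (n • lin f) (by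
  ext x; simp [comm_apply, LinearMap.rTensor, TensorProduct.map_smul_left,
    ← Int.cast_smul_eq_zsmul k])⟩

instance : AddCommGroup (M ⟶ N) :=
  lin_injective.addCommGroup _ rfl (fun _ _ => rfl) (fun _ => rfl) (fun _ _ => rfl)
    (fun _ _ => rfl) (fun _ _ => rfl)

@[simp] theorem zero_lin : lin (0 : M ⟶ N) = 0 := rfl

@[simp] theorem add_lin (f g : M ⟶ N) : lin (f + g) = lin f + lin g := rfl

@[simp] theorem sub_lin (f g : M ⟶ N) : lin (f - g) = lin f - lin g := rfl

instance : Preadditive (GModule k A) where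
  add_comp _ _ _ f f' g := by ext x; simp
  comp_add _ _ _ f g g' := by ext x; simp

theorem zero_of_comp_lin {f : M ⟶ N} {g : N ⟶ P} (h : f ≫ g = 0) : lin g ∘ₗ lin f = 0 :=
  congrArg lin h

section Transport

variable {V W : Type u} [AddCommGroup V] [Module k V] [AddCommGroup W] [Module k W]
  {f : V →ₗ[k] W} {r : V →ₗ[k] V ⊗[k] A} {s : W →ₗ[k] W ⊗[k] A}

theorem coassoc_left (h : s ∘ₗ f = f.rTensor A ∘ₗ r) :
    ((TensorProduct.assoc k W A A).toLinearMap ∘ₗ s.rTensor A ∘ₗ s) ∘ₗ f =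
      f.rTensor (A ⊗[k] A) ∘ₗ
        ((TensorProduct.assoc k V A A).toLinearMap ∘ₗ r.rTensor A ∘ₗ r) := by
  have h1 : (TensorProduct.assoc k W A A).toLinearMap ∘ₗ (f.rTensor A).rTensor A =
      f.rTensor (A ⊗[k] A) ∘ₗ (TensorProduct.assoc k V A A).toLinearMap := by
    ext; simp
  rw [LinearMap.comp_assoc, LinearMap.comp_assoc, h, ← LinearMap.comp_assoc _ _ (s.rTensor A),
    ← LinearMap.rTensor_comp, h, LinearMap.rTensor_comp, LinearMap.comp_assoc,
    ← LinearMap.comp_assoc, h1, LinearMap.comp_assoc]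

theorem coassoc_right (h : s ∘ₗ f = f.rTensor A ∘ₗ r) :
    ((Coalgebra.comul (R := k) (A := A)).lTensor W ∘ₗ s) ∘ₗ f =
      f.rTensor (A ⊗[k] A) ∘ₗ ((Coalgebra.comul (R := k) (A := A)).lTensor V ∘ₗ r) := by
  rw [LinearMap.comp_assoc, h, ← LinearMap.comp_assoc, ← LinearMap.comp_assoc,
    LinearMap.lTensor_comp_rTensor, LinearMap.rTensor_comp_lTensor]

theorem counit_left (h : s ∘ₗ f = f.rTensor A ∘ₗ r) :
    ((TensorProduct.rid k W).toLinearMap ∘ₗ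
        (Coalgebra.counit (R := k) (A := A)).lTensor W ∘ₗ s) ∘ₗ f =
      f ∘ₗ ((TensorProduct.rid k V).toLinearMap ∘ₗ
        (Coalgebra.counit (R := k) (A := A)).lTensor V ∘ₗ r) := by
  have h1 : (TensorProduct.rid k W).toLinearMap ∘ₗ f.rTensor k =
      f ∘ₗ (TensorProduct.rid k V).toLinearMap := by
    ext; simp
  rw [LinearMap.comp_assoc, LinearMap.comp_assoc, h, ← LinearMap.comp_assoc _ _ (LinearMap.lTensor _ _),
    LinearMap.lTensor_comp_rTensor, ← LinearMap.rTensor_comp_lTensor, LinearMap.comp_assoc,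
    ← LinearMap.comp_assoc, h1, LinearMap.comp_assoc]

end Transport

/-- The zero `G`-module. -/
def zeroObj : GModule k A where
  V := PUnit
  coact := 0
  coassoc := by simp
  counit := LinearMap.ext fun _ => rfl

instance : HasZeroObject (GModule k A) :=
  ⟨zeroObj, (IsZero.iff_id_eq_zero _).2 (hom_ext (LinearMap.ext fun _ => rfl))⟩

section Prod

variable {V W : Type u} [AddCommGroup V] [Module k V] [AddCommGroup W] [Module k W]
  (r : V →ₗ[k] V ⊗[k] A) (s : W →ₗ[k] W ⊗[k] A)

/-- The coaction on a direct sum. -/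
def prodCoact : V × W →ₗ[k] (V × W) ⊗[k] A :=
  ((LinearMap.inl k V W).rTensor A ∘ₗ r).coprod ((LinearMap.inr k V W).rTensor A ∘ₗ s)

theorem prodCoact_inl :
    prodCoact r s ∘ₗ LinearMap.inl k V W = (LinearMap.inl k V W).rTensor A ∘ₗ r :=
  LinearMap.coprod_inl _ _

theorem prodCoact_inr :
    prodCoact r s ∘ₗ LinearMap.inr k V W = (LinearMap.inr k V W).rTensor A ∘ₗ s :=
  LinearMap.coprod_inr _ _

theorem prodCoact_fst :
    r ∘ₗ LinearMap.fst k V W = (LinearMap.fst k V W).rTensor A ∘ₗ prodCoact r s := by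
  refine LinearMap.prod_ext ?_ ?_
  · rw [LinearMap.comp_assoc, LinearMap.comp_assoc, prodCoact_inl,
      ← LinearMap.comp_assoc _ _ (LinearMap.rTensor A _), ← LinearMap.rTensor_comp,
      LinearMap.fst_comp_inl]
    simp
  · rw [LinearMap.comp_assoc, LinearMap.comp_assoc, prodCoact_inr,
      ← LinearMap.comp_assoc _ _ (LinearMap.rTensor A _), ← LinearMap.rTensor_comp,
      LinearMap.fst_comp_inr]
    simp

theorem prodCoact_snd :
    s ∘ₗ LinearMap.snd k V W = (LinearMap.snd k V W).rTensor A ∘ₗ prodCoact r s := by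
  refine LinearMap.prod_ext ?_ ?_
  · rw [LinearMap.comp_assoc, LinearMap.comp_assoc, prodCoact_inl,
      ← LinearMap.comp_assoc _ _ (LinearMap.rTensor A _), ← LinearMap.rTensor_comp,
      LinearMap.snd_comp_inl]
    simp
  · rw [LinearMap.comp_assoc, LinearMap.comp_assoc, prodCoact_inr,
      ← LinearMap.comp_assoc _ _ (LinearMap.rTensor A _), ← LinearMap.rTensor_comp,
      LinearMap.snd_comp_inr]
    simp

end Prod

/-- The direct sum of two `G`-modules. -/
def prod (M N : GModule k A) : GModule k A where
  V := M.V × N.V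
  coact := prodCoact M.coact N.coact
  coassoc := by
    refine LinearMap.prod_ext ?_ ?_
    · rw [coassoc_left (prodCoact_inl _ _), coassoc_right (prodCoact_inl _ _), M.coassoc]
    · rw [coassoc_left (prodCoact_inr _ _), coassoc_right (prodCoact_inr _ _), N.coassoc]
  counit := by
    refine LinearMap.prod_ext ?_ ?_
    · rw [counit_left (prodCoact_inl _ _), M.counit]; rfl
    · rw [counit_left (prodCoact_inr _ _), N.counit]; rfl

/-- The direct sum of two `G`-modules, with its projections and inclusions. -/
def bicone (M N : GModule k A) : BinaryBicone M N where
  pt := prod M N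
  fst := homMk (LinearMap.fst k M.V N.V) (prodCoact_fst _ _)
  snd := homMk (LinearMap.snd k M.V N.V) (prodCoact_snd _ _)
  inl := homMk (LinearMap.inl k M.V N.V) (prodCoact_inl _ _)
  inr := homMk (LinearMap.inr k M.V N.V) (prodCoact_inr _ _)
  inl_fst := hom_ext (LinearMap.ext fun _ => rfl)
  inl_snd := hom_ext (LinearMap.ext fun _ => rfl)
  inr_fst := hom_ext (LinearMap.ext fun _ => rfl)
  inr_snd := hom_ext (LinearMap.ext fun _ => rfl)

instance : HasBinaryBiproducts (GModule k A) where
  has_binary_biproduct M N := hasBinaryBiproduct_of_total (bicone M N)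
    (hom_ext (LinearMap.ext fun x => Prod.ext (add_zero x.1) (zero_add x.2)))

instance : HasFiniteProducts (GModule k A) := by
  have : HasTerminal (GModule k A) := HasZeroObject.hasTerminal
  exact hasFiniteProducts_of_has_binary_and_terminal

/-! ### Cokernels -/

/-- The coaction on the quotient of `N` by the image of a morphism. -/
def quotCoact (f : M ⟶ N) :
    (N.V ⧸ LinearMap.range (lin f)) →ₗ[k] (N.V ⧸ LinearMap.range (lin f)) ⊗[k] A :=
  (LinearMap.range (lin f)).liftQ ((LinearMap.range (lin f)).mkQ.rTensor A ∘ₗ N.coact) (by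
    rw [LinearMap.range_le_ker_iff, LinearMap.comp_assoc, comm f, ← LinearMap.comp_assoc,
      ← LinearMap.rTensor_comp, LinearMap.range_mkQ_comp]
    simp)

theorem quotCoact_comp (f : M ⟶ N) : quotCoact f ∘ₗ (LinearMap.range (lin f)).mkQ =
    (LinearMap.range (lin f)).mkQ.rTensor A ∘ₗ N.coact :=
  Submodule.liftQ_mkQ _ _ _

/-- The cokernel of a morphism of `G`-modules. -/
def coker (f : M ⟶ N) : GModule k A where
  V := N.V ⧸ LinearMap.range (lin f)
  coact := quotCoact f
  coassoc := by
    refine Submodule.linearMap_qext _ ?_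
    rw [coassoc_left (quotCoact_comp f), coassoc_right (quotCoact_comp f), N.coassoc]
  counit := by
    refine Submodule.linearMap_qext _ ?_
    rw [counit_left (quotCoact_comp f), N.counit]; rfl

/-- The projection to the cokernel. -/
def cokerπ (f : M ⟶ N) : N ⟶ coker f :=
  homMk (LinearMap.range (lin f)).mkQ (quotCoact_comp f)

theorem comp_cokerπ (f : M ⟶ N) : f ≫ cokerπ f = 0 :=
  hom_ext (LinearMap.range_mkQ_comp (lin f))

theorem surjective_cokerπ (f : M ⟶ N) : Function.Surjective (lin (cokerπ f)) :=
  Submodule.mkQ_surjective _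

theorem ker_cokerπ (f : M ⟶ N) : LinearMap.ker (lin (cokerπ f)) = LinearMap.range (lin f) :=
  Submodule.ker_mkQ _

/-- A surjective morphism of `G`-modules is a cokernel of any morphism onto its kernel. -/
theorem isColimit_of_exact (f : M ⟶ N) (g : N ⟶ P) (w : f ≫ g = 0)
    (hg : Function.Surjective (lin g)) (he : LinearMap.ker (lin g) ≤ LinearMap.range (lin f)) :
    Nonempty (IsColimit (CokernelCofork.ofπ g w)) := by
  have key : ∀ {Q : GModule k A} (t : N ⟶ Q), f ≫ t = 0 → ∃ l : P ⟶ Q, g ≫ l = t := by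
    intro Q t ht
    have hker : LinearMap.ker (lin g) ≤ LinearMap.ker (lin t) :=
      he.trans (LinearMap.range_le_ker_iff.2 (zero_of_comp_lin ht))
    let e := (lin g).quotKerEquivOfSurjective hg
    let l : P.V →ₗ[k] Q.V := (LinearMap.ker (lin g)).liftQ (lin t) hker ∘ₗ e.symm.toLinearMap
    have hl : l ∘ₗ lin g = lin t := by
      ext x
      have : e.symm (lin g x) = Submodule.Quotient.mk x := by
        rw [LinearEquiv.symm_apply_eq]; rfl
      simp [l, this]
    refine ⟨homMk l ?_, hom_ext hl⟩
    rw [← LinearMap.cancel_right hg, LinearMap.comp_assoc, hl, comm t, LinearMap.comp_assoc, comm g,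
      ← LinearMap.comp_assoc, ← LinearMap.rTensor_comp, hl]
  have hepi : ∀ {Q : GModule k A} (a b : P ⟶ Q), g ≫ a = g ≫ b → a = b := fun a b h =>
    hom_ext ((LinearMap.cancel_right hg).1 (congrArg lin h))
  exact ⟨CokernelCofork.IsColimit.ofπ g w (fun t ht => (key t ht).choose)
    (fun t ht => (key t ht).choose_spec)
    (fun t ht m hm => hepi _ _ (hm.trans (key t ht).choose_spec.symm))⟩

instance : HasCokernels (GModule k A) where
  has_colimit f := ⟨⟨⟨_, (isColimit_of_exact f (cokerπ f) (comp_cokerπ f) (surjective_cokerπ f)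
    (ker_cokerπ f).le).some⟩⟩⟩

theorem surjective_of_epi (f : M ⟶ N) [Epi f] : Function.Surjective (lin f) := by
  have h : cokerπ f = 0 := by rw [← cancel_epi f, comp_cokerπ, comp_zero]
  rw [← LinearMap.range_eq_top, ← ker_cokerπ, h, zero_lin, LinearMap.ker_zero]

/-! ### Kernels (this needs flatness of `G`) -/

section Flat

variable [Module.Flat k A]

theorem exists_kerCoact (f : M ⟶ N) :
    ∃ r : LinearMap.ker (lin f) →ₗ[k] LinearMap.ker (lin f) ⊗[k] A,
      M.coact ∘ₗ (LinearMap.ker (lin f)).subtype =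
        (LinearMap.ker (lin f)).subtype.rTensor A ∘ₗ r := by
  let i := (LinearMap.ker (lin f)).subtype
  have hi : Function.Injective (i.rTensor A) :=
    Module.Flat.rTensor_preserves_injective_linearMap i Subtype.val_injective
  have hex : Function.Exact (i.rTensor A) ((lin f).rTensor A) :=
    Module.Flat.rTensor_exact A (LinearMap.exact_subtype_ker_map (lin f))
  have hr : ∀ x, (M.coact ∘ₗ i) x ∈ LinearMap.range (i.rTensor A) := fun x =>
    (hex _).1 (by
      change (lin f).rTensor A (M.coact x) = 0
      rw [← comm_apply, x.2, map_zero])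
  refine ⟨(LinearEquiv.ofInjective _ hi).symm.toLinearMap ∘ₗ
    (M.coact ∘ₗ i).codRestrict (LinearMap.range (i.rTensor A)) hr, LinearMap.ext fun x => ?_⟩
  have := (LinearEquiv.ofInjective _ hi).apply_symm_apply
    ((M.coact ∘ₗ i).codRestrict (LinearMap.range (i.rTensor A)) hr x)
  exact (congrArg Subtype.val this).symm

/-- The kernel of a morphism of `G`-modules, with the restricted coaction. -/
def ker (f : M ⟶ N) : GModule k A where
  V := LinearMap.ker (lin f)
  coact := (exists_kerCoact f).choose
  coassoc := by
    have h := (exists_kerCoact f).choose_spec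
    have hi : Function.Injective ((LinearMap.ker (lin f)).subtype.rTensor (A ⊗[k] A)) :=
      Module.Flat.rTensor_preserves_injective_linearMap _ Subtype.val_injective
    rw [← LinearMap.cancel_left hi, ← coassoc_left h, ← coassoc_right h, M.coassoc]
  counit := by
    have h := (exists_kerCoact f).choose_spec
    have hi : Function.Injective (LinearMap.ker (lin f)).subtype := Subtype.val_injective
    rw [← LinearMap.cancel_left hi, ← counit_left h, M.counit]; rfl

/-- The inclusion of the kernel. -/
def kerι (f : M ⟶ N) : ker f ⟶ M :=
  homMk (LinearMap.ker (lin f)).subtype (exists_kerCoact f).choose_spec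

theorem kerι_comp (f : M ⟶ N) : kerι f ≫ f = 0 :=
  hom_ext (LinearMap.comp_ker_subtype (lin f))

theorem injective_kerι (f : M ⟶ N) : Function.Injective (lin (kerι f)) := Subtype.val_injective

theorem range_kerι (f : M ⟶ N) : LinearMap.range (lin (kerι f)) = LinearMap.ker (lin f) :=
  Submodule.range_subtype _

/-- An injective morphism of `G`-modules is a kernel of any morphism whose kernel is its image. -/
theorem isLimit_of_exact (f : M ⟶ N) (g : N ⟶ P) (w : f ≫ g = 0)
    (hf : Function.Injective (lin f)) (he : LinearMap.ker (lin g) ≤ LinearMap.range (lin f)) :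
    Nonempty (IsLimit (KernelFork.ofι f w)) := by
  have key : ∀ {Q : GModule k A} (t : Q ⟶ N), t ≫ g = 0 → ∃ l : Q ⟶ M, l ≫ f = t := by
    intro Q t ht
    have hr : ∀ x, lin t x ∈ LinearMap.range (lin f) := fun x =>
      he (LinearMap.congr_fun (zero_of_comp_lin ht) x)
    let e := LinearEquiv.ofInjective (lin f) hf
    let l : Q.V →ₗ[k] M.V := e.symm.toLinearMap ∘ₗ (lin t).codRestrict _ hr
    have hl : lin f ∘ₗ l = lin t := LinearMap.ext fun x =>
      congrArg Subtype.val (e.apply_symm_apply ((lin t).codRestrict _ hr x))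
    have hfA : Function.Injective ((lin f).rTensor A) :=
      Module.Flat.rTensor_preserves_injective_linearMap _ hf
    refine ⟨homMk l ?_, hom_ext hl⟩
    rw [← LinearMap.cancel_left hfA, ← LinearMap.comp_assoc, ← comm f, LinearMap.comp_assoc, hl,
      ← LinearMap.comp_assoc, ← LinearMap.rTensor_comp, hl, comm t]
  have hmono : ∀ {Q : GModule k A} (a b : Q ⟶ M), a ≫ f = b ≫ f → a = b := fun a b h =>
    hom_ext ((LinearMap.cancel_left hf).1 (congrArg lin h))
  exact ⟨KernelFork.IsLimit.ofι f w (fun t ht => (key t ht).choose)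
    (fun t ht => (key t ht).choose_spec)
    (fun t ht m hm => hmono _ _ (hm.trans (key t ht).choose_spec.symm))⟩

instance : HasKernels (GModule k A) where
  has_limit f := ⟨⟨⟨_, (isLimit_of_exact (kerι f) f (kerι_comp f) (injective_kerι f)
    (range_kerι f).ge).some⟩⟩⟩

theorem injective_of_mono (f : M ⟶ N) [Mono f] : Function.Injective (lin f) := by
  have h : kerι f = 0 := by rw [← cancel_mono f, kerι_comp, zero_comp]
  rw [← LinearMap.ker_eq_bot, ← range_kerι, h, zero_lin, LinearMap.range_zero]

instance : Abelian (GModule k A) where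
  normalMonoOfMono f _ := ⟨{
    Z := coker f
    g := cokerπ f
    w := comp_cokerπ f
    isLimit := (isLimit_of_exact f (cokerπ f) (comp_cokerπ f) (injective_of_mono f)
      (ker_cokerπ f).le).some }⟩
  normalEpiOfEpi f _ := ⟨{
    W := ker f
    g := kerι f
    w := kerι_comp f
    isColimit := (isColimit_of_exact (kerι f) f (kerι_comp f) (surjective_of_epi f)
      (range_kerι f).ge).some }⟩

end Flat

/-! ### Enough injectives -/

section Cofree

variable (E : Type u) [AddCommGroup E] [Module k E]

/-- The coaction `id ⊗ Δ` on `E ⊗ k[G]`. -/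
def cofreeCoact : E ⊗[k] A →ₗ[k] (E ⊗[k] A) ⊗[k] A :=
  (TensorProduct.assoc k E A A).symm.toLinearMap ∘ₗ
    (Coalgebra.comul (R := k) (A := A)).lTensor E

theorem cofreeCoact_mk (e : E) : cofreeCoact E ∘ₗ TensorProduct.mk k E A e =
    (TensorProduct.mk k E A e).rTensor A ∘ₗ Coalgebra.comul (R := k) (A := A) := by
  have h : (TensorProduct.assoc k E A A).symm.toLinearMap ∘ₗ TensorProduct.mk k E (A ⊗[k] A) e =
      (TensorProduct.mk k E A e).rTensor A := by
    ext; simp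
  rw [← h]
  rfl

/-- The map `id ⊗ ε : E ⊗ k[G] → E`. -/
def cofreeCounit : E ⊗[k] A →ₗ[k] E :=
  (TensorProduct.rid k E).toLinearMap ∘ₗ (Coalgebra.counit (R := k) (A := A)).lTensor E

theorem cofreeCounit_coact :
    (cofreeCounit (k := k) (A := A) E).rTensor A ∘ₗ cofreeCoact E = LinearMap.id := by
  refine TensorProduct.ext (LinearMap.ext fun e => ?_)
  change ((cofreeCounit (k := k) (A := A) E).rTensor A ∘ₗ cofreeCoact E) ∘ₗ TensorProduct.mk k E A e =
    TensorProduct.mk k E A e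
  have h : cofreeCounit (k := k) (A := A) E ∘ₗ TensorProduct.mk k E A e =
      LinearMap.toSpanSingleton k E e ∘ₗ Coalgebra.counit (R := k) (A := A) := by
    ext a; simp [cofreeCounit]
  rw [LinearMap.comp_assoc, cofreeCoact_mk, ← LinearMap.comp_assoc, ← LinearMap.rTensor_comp, h,
    LinearMap.rTensor_comp, LinearMap.comp_assoc, Coalgebra.rTensor_counit_comp_comul]
  ext a
  simp

variable {E} {V : Type u} [AddCommGroup V] [Module k V] {r : V →ₗ[k] V ⊗[k] A}

theorem cofreeCoact_comp
    (hr : (TensorProduct.assoc k V A A).toLinearMap ∘ₗ r.rTensor A ∘ₗ r =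
      (Coalgebra.comul (R := k) (A := A)).lTensor V ∘ₗ r) (t : V →ₗ[k] E) :
    cofreeCoact E ∘ₗ (t.rTensor A ∘ₗ r) = (t.rTensor A ∘ₗ r).rTensor A ∘ₗ r := by
  have h1 : (TensorProduct.assoc k E A A).symm.toLinearMap ∘ₗ t.rTensor (A ⊗[k] A) =
      (t.rTensor A).rTensor A ∘ₗ (TensorProduct.assoc k V A A).symm.toLinearMap := by
    ext; simp
  have h2 : (TensorProduct.assoc k V A A).symm.toLinearMap ∘ₗ
      (Coalgebra.comul (R := k) (A := A)).lTensor V ∘ₗ r = r.rTensor A ∘ₗ r := by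
    rw [← hr]; ext; simp
  rw [cofreeCoact, ← LinearMap.comp_assoc, LinearMap.comp_assoc _ _ (LinearEquiv.toLinearMap _),
    LinearMap.lTensor_comp_rTensor, ← LinearMap.rTensor_comp_lTensor, ← LinearMap.comp_assoc, h1,
    LinearMap.comp_assoc, LinearMap.comp_assoc, h2, LinearMap.rTensor_comp, LinearMap.comp_assoc]

theorem cofreeCounit_comp (hr : (TensorProduct.rid k V).toLinearMap ∘ₗ
      (Coalgebra.counit (R := k) (A := A)).lTensor V ∘ₗ r = LinearMap.id) (t : V →ₗ[k] E) :
    cofreeCounit E ∘ₗ (t.rTensor A ∘ₗ r) = t := by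
  have h1 : cofreeCounit (A := A) E ∘ₗ t.rTensor A = t ∘ₗ cofreeCounit (A := A) V := by
    ext; simp [cofreeCounit]
  have h2 : cofreeCounit (A := A) V ∘ₗ r = LinearMap.id := hr
  rw [← LinearMap.comp_assoc, h1, LinearMap.comp_assoc, h2, LinearMap.comp_id]

theorem cofreeCounit_comp_rTensor (g : V →ₗ[k] E ⊗[k] A)
    (hg : cofreeCoact E ∘ₗ g = g.rTensor A ∘ₗ r) :
    (cofreeCounit (A := A) E ∘ₗ g).rTensor A ∘ₗ r = g := by
  rw [LinearMap.rTensor_comp, LinearMap.comp_assoc, ← hg, ← LinearMap.comp_assoc,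
    cofreeCounit_coact, LinearMap.id_comp]

variable (k A E)

/-- The `G`-module `E ⊗ k[G]` for a `k`-module `E`, with coaction `id ⊗ Δ`. -/
def cofree : GModule k A where
  V := E ⊗[k] A
  coact := cofreeCoact E
  coassoc := by
    refine TensorProduct.ext (LinearMap.ext fun e => ?_)
    have h1 := coassoc_left (cofreeCoact_mk (A := A) (k := k) E e)
    have h2 := coassoc_right (cofreeCoact_mk (A := A) (k := k) E e)
    rw [Coalgebra.coassoc] at h1
    exact h1.trans h2.symm
  counit := by
    refine TensorProduct.ext (LinearMap.ext fun e => ?_)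
    have h := counit_left (cofreeCoact_mk (A := A) (k := k) E e)
    rw [Coalgebra.lTensor_counit_comp_comul] at h
    refine h.trans (LinearMap.ext fun a => ?_)
    change TensorProduct.mk k E A e (TensorProduct.rid k A (a ⊗ₜ[k] (1 : k))) = e ⊗ₜ[k] a
    simp

variable {k A E}

/-- The morphism of `G`-modules `M → E ⊗ k[G]` attached to a linear map `M → E`. -/
def toCofree (t : M.V →ₗ[k] E) : M ⟶ cofree k A E :=
  homMk (N := cofree k A E) (t.rTensor A ∘ₗ M.coact) (cofreeCoact_comp M.coassoc t)

theorem comp_toCofree (f : M ⟶ N) (t : N.V →ₗ[k] E) :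
    f ≫ toCofree t = toCofree (t ∘ₗ lin f) := by
  refine hom_ext ?_
  change (t.rTensor A ∘ₗ N.coact) ∘ₗ lin f = (t ∘ₗ lin f).rTensor A ∘ₗ M.coact
  rw [LinearMap.comp_assoc, comm f, LinearMap.rTensor_comp, LinearMap.comp_assoc]

theorem exists_toCofree (g : M ⟶ cofree k A E) :
    ∃ t : M.V →ₗ[k] E, toCofree t = g :=
  ⟨cofreeCounit (A := A) E ∘ₗ (lin g : M.V →ₗ[k] E ⊗[k] A),
    hom_ext (cofreeCounit_comp_rTensor (lin g : M.V →ₗ[k] E ⊗[k] A) (comm g))⟩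

theorem injective_toCofree (t : M.V →ₗ[k] E) (ht : Function.Injective t) :
    Function.Injective (lin (toCofree t)) := by
  intro x y h
  refine ht ?_
  have h1 := LinearMap.congr_fun (cofreeCounit_comp M.counit t)
  exact (h1 x).symm.trans ((congrArg (cofreeCounit (k := k) (A := A) E) h).trans (h1 y))

end Cofree

theorem injective_cofree [Module.Flat k A] (E : ModuleCat.{u} k) [Injective E] :
    Injective (cofree k A E) where
  factors {X Y} g f _ := by
    have : Mono (ModuleCat.ofHom (lin f)) :=
      (ModuleCat.mono_iff_injective _).2 (injective_of_mono f)
    obtain ⟨s, rfl⟩ := exists_toCofree g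
    let t := Injective.factorThru (ModuleCat.ofHom s) (ModuleCat.ofHom (lin f))
    have ht : t.hom ∘ₗ lin f = s := congrArg ModuleCat.Hom.hom
      (Injective.comp_factorThru (ModuleCat.ofHom s) (ModuleCat.ofHom (lin f)))
    exact ⟨toCofree t.hom, by rw [comp_toCofree, ht]⟩

instance [Module.Flat k A] : EnoughInjectives (GModule k A) where
  presentation M := by
    let i : ModuleCat.of k M.V ⟶ Injective.under (ModuleCat.of k M.V) := Injective.ι _
    have hi : Function.Injective i.hom := (ModuleCat.mono_iff_injective i).1 inferInstance
    exact ⟨{ J := cofree k A ((Injective.under (ModuleCat.of k M.V) : ModuleCat.{u} k) : Type u)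
             injective := injective_cofree (Injective.under (ModuleCat.of k M.V))
             f := toCofree i.hom
             mono := ⟨fun a b h => hom_ext
               ((LinearMap.cancel_left (injective_toCofree i.hom hi)).1 (congrArg lin h))⟩ }⟩

/-! ### Invariants and cohomology -/

/-- The submodule of invariants `M^G`: the elements `m` whose coaction is `m ⊗ 1`. -/
def invariants (M : GModule k A) : Submodule k M.V :=
  LinearMap.ker (M.coact - (TensorProduct.mk k M.V A).flip 1)

theorem mem_invariants (m : M.V) : m ∈ invariants M ↔ M.coact m = m ⊗ₜ[k] (1 : A) := by
  simp [invariants, sub_eq_zero]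

/-- The functor of invariants `M ↦ M^G`. -/
def invariantsFunctor (k : Type u) [CommRing k] (A : Type u) [CommRing A] [HopfAlgebra k A] :
    GModule k A ⥤ ModuleCat.{u} k where
  obj M := ModuleCat.of k (invariants M)
  map {M N} f := ModuleCat.ofHom ((lin f).restrict (p := invariants M) (q := invariants N)
    fun m hm => by rw [mem_invariants] at hm ⊢; rw [comm_apply, hm]; rfl)

instance : (invariantsFunctor k A).Additive where

/-- The cohomology `H^i(G, M)`: the value at `M` of the `i`-th right derived functor of the functor
of invariants on the category of `G`-modules. -/
def cohomology [Module.Flat k A] (i : ℕ) (M : GModule k A) : ModuleCat.{u} k :=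
  ((invariantsFunctor k A).rightDerived i).obj M

end GModule

end

/-!
The order of a finite group kills its cohomology, because summing over the group retracts a module
onto its invariants up to the factor `|G|`. For a finite flat group scheme the sum over the group is
replaced by the trace form of `k[G]`.

Since `k` is noetherian, `k[G]` is finitely generated projective, so multiplication by `a ∈ k[G]`
has a trace `t(a) ∈ k` (`splitTrace`). Translations are algebra automorphisms of `k[G]`, and
automorphisms preserve `t` (`splitTrace_algEquiv`); applied to the universal translation, the shear
automorphism `a ⊗ b ↦ (a ⊗ 1) Δ(b)` of `k[G] ⊗ k[G]`, this gives `(id ⊗ t) Δ(a) = t(a) 1`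
(`lTensor_splitTrace_comul`). Hence contracting the coaction of `M` with `t` defines a natural map
`M → M^G` which is multiplication by `t(1)` on `M^G` (`GModule.average`). So multiplication by
`t(1)` on the functor of invariants factors through the functor forgetting the action, which is
exact, and `t(1)` kills `H^i(G, M)` for `i > 0` (`GModule.nsmul_cohomology_eq_zero`).

Finally `t(1)`, the rank of `k[G]`, is locally on `k` an integer between `1` and the rank `N` of a
free module of which `k[G]` is a direct summand; it is positive because the counit splits
`k → k[G]`. Therefore `∏ i ∈ {1, …, N}, (i - t(1)) = 0` (`prod_sub_splitTrace_one`), so `t(1)`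
divides `N!` in `k`, and `N!` kills the cohomology.
-/

noncomputable section

/-! ### Traces on direct summands of free modules -/

section SplitTrace

open LinearMap

variable {R B F : Type*} [CommRing R] [CommRing B] [Algebra R B] [AddCommGroup F] [Module R F]

/-- The trace of multiplication by `b` on an algebra `B` presented as a direct summand of a finite
free module `F`, through `s : B → F` and `p : F → B` with `p ∘ s = id`: it is the trace on `F` of
the extension of this multiplication by zero. (`LinearMap.trace` itself is zero on modules
without a basis.) -/
def splitTrace (s : B →ₗ[R] F) (p : F →ₗ[R] B) : B →ₗ[R] R where
  toFun b := trace R F (s ∘ₗ mulLeft R b ∘ₗ p)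
  map_add' a b := by
    rw [← map_add, ← LinearMap.comp_add, ← LinearMap.add_comp]
    congr 3
    ext x
    simp [add_mul]
  map_smul' c b := by
    rw [RingHom.id_apply, ← map_smul, ← LinearMap.comp_smul, ← LinearMap.smul_comp]
    congr 3
    ext x
    simp

theorem splitTrace_apply (s : B →ₗ[R] F) (p : F →ₗ[R] B) (b : B) :
    splitTrace s p b = trace R F (s ∘ₗ mulLeft R b ∘ₗ p) := rfl

theorem splitTrace_one (s : B →ₗ[R] F) (p : F →ₗ[R] B) :
    splitTrace s p 1 = trace R F (s ∘ₗ p) := by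
  rw [splitTrace_apply, mulLeft_one, LinearMap.id_comp]

variable [Module.Free R F] [Module.Finite R F]

/-- Conjugation by `e` turns multiplication by `b` into multiplication by `e b`; the claim is then
the cyclicity of the trace on `F`. -/
theorem splitTrace_algEquiv {s : B →ₗ[R] F} {p : F →ₗ[R] B} (h : p ∘ₗ s = LinearMap.id)
    (e : B ≃ₐ[R] B) (b : B) : splitTrace s p (e b) = splitTrace s p b := by
  have hps (x : B) : p (s x) = x := LinearMap.congr_fun h x
  have h1 : s ∘ₗ mulLeft R (e b) ∘ₗ p = (s ∘ₗ e.toLinearMap ∘ₗ mulLeft R b ∘ₗ p) ∘ₗ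
      (s ∘ₗ e.symm.toLinearMap ∘ₗ p) := by
    ext x
    simp [hps]
  have h2 : s ∘ₗ mulLeft R b ∘ₗ p = (s ∘ₗ e.symm.toLinearMap ∘ₗ p) ∘ₗ
      (s ∘ₗ e.toLinearMap ∘ₗ mulLeft R b ∘ₗ p) := by
    ext x
    simp [hps]
  rw [splitTrace_apply, splitTrace_apply, h1, h2, trace_comp_comm']

theorem splitTrace_baseChange (S : Type*) [CommRing S] [Algebra R S] (s : B →ₗ[R] F)
    (p : F →ₗ[R] B) (x : S ⊗[R] B) :
    splitTrace (s.baseChange S) (p.baseChange S) x =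
      TensorProduct.rid R S ((splitTrace s p).lTensor S x) := by
  induction x with
  | zero => simp
  | add x y hx hy => simp only [map_add, hx, hy]
  | tmul c b =>
    have h : s.baseChange S ∘ₗ mulLeft S (c ⊗ₜ[R] b) ∘ₗ p.baseChange S =
        c • (s ∘ₗ mulLeft R b ∘ₗ p).baseChange S := by
      ext y
      simp [TensorProduct.smul_tmul']
    rw [splitTrace_apply, h, map_smul, trace_baseChange]
    simp [splitTrace_apply, Algebra.smul_def, mul_comm]

end SplitTrace

/-! ### The rank of an augmented algebra -/

section Rank

open LinearMap

theorem IsIdempotentElem.free_range {R M : Type*} [CommRing R] [IsLocalRing R]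
    [AddCommGroup M] [Module R M] [Module.Free R M] [Module.Finite R M] {e : M →ₗ[R] M}
    (he : IsIdempotentElem e) : Module.Free R (range e) := by
  have : Module.Projective R (range e) :=
    Module.Projective.of_split (range e).subtype e.rangeRestrict (by
      ext ⟨_, x, rfl⟩
      exact LinearMap.congr_fun he x)
  exact Module.free_of_flat_of_isLocalRing

theorem IsIdempotentElem.trace_eq_finrank_range {R M : Type*} [CommRing R] [IsLocalRing R]
    [AddCommGroup M] [Module R M] [Module.Free R M] [Module.Finite R M] {e : M →ₗ[R] M}
    (he : IsIdempotentElem e) : trace R M e = Module.finrank R (range e) := by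
  have hker : ker e = range (1 - e) := he.ker_eq_range_one_sub
  have := he.free_range
  have : Module.Free R (ker e) := hker ▸ he.one_sub.free_range
  have : Module.Finite R (ker e) := hker ▸ inferInstance
  exact he.isProj_range.trace

variable {R B F : Type*} [CommRing R] [CommRing B] [Algebra R B] [AddCommGroup F] [Module R F]
  [Module.Free R F] [Module.Finite R F]

/-- Over a local `R`-algebra, `splitTrace s p 1` becomes the rank of `B`, a natural number between
`1` and the rank of `F`; it is not `0` because `R` is a retract of `B`. -/
theorem exists_algebraMap_splitTrace_one_eq (S : Type*) [CommRing S] [IsLocalRing S] [Algebra R S]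
    {s : B →ₗ[R] F} {p : F →ₗ[R] B} (h : p ∘ₗ s = LinearMap.id) (ε : B →ₐ[R] R) :
    ∃ i < Module.finrank R F, algebraMap R S (splitTrace s p 1) = (i + 1 : ℕ) := by
  have hps (x : B) : p (s x) = x := LinearMap.congr_fun h x
  have : Nontrivial R := RingHom.domain_nontrivial (algebraMap R S)
  let e : S ⊗[R] F →ₗ[S] S ⊗[R] F := (s ∘ₗ p).baseChange S
  have he : IsIdempotentElem e := by
    change e ∘ₗ e = e
    rw [← LinearMap.baseChange_comp]
    congr 1
    ext x
    simp [hps]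
  have hle : Module.finrank S (range e) ≤ Module.finrank R F :=
    (Submodule.finrank_le _).trans_eq Module.finrank_baseChange
  have hpos : 0 < Module.finrank S (range e) := by
    have hne : Nontrivial (range e) := by
      refine nontrivial_of_ne ⟨_, LinearMap.mem_range_self e ((1 : S) ⊗ₜ[R] s 1)⟩ 0 fun h0 => ?_
      have h1 : (1 : S) ⊗ₜ[R] s 1 = 0 := by
        simpa [e, hps] using congrArg Subtype.val h0
      -- The functional `ε ∘ p` takes the value `1` at the vector `s 1`.
      have h2 := congrArg (TensorProduct.rid R S ∘ (ε.toLinearMap ∘ₗ p).lTensor S) h1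
      simp [hps] at h2
    have := he.free_range
    exact (Module.finrank_pos_iff_of_free S (range e)).2 hne
  refine ⟨Module.finrank S (range e) - 1, by omega, ?_⟩
  rw [Nat.sub_add_cancel hpos, splitTrace_one, ← trace_baseChange, he.trace_eq_finrank_range]

theorem prod_sub_splitTrace_one {s : B →ₗ[R] F} {p : F →ₗ[R] B} (h : p ∘ₗ s = LinearMap.id)
    (ε : B →ₐ[R] R) :
    ∏ i ∈ Finset.range (Module.finrank R F), (((i + 1 : ℕ) : R) - splitTrace s p 1) = 0 := by
  refine Module.eq_zero_of_localization_maximal (fun P _ => Localization.AtPrime P)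
    (fun P _ => Algebra.linearMap R _) _ fun P _ => ?_
  obtain ⟨i, hi, h1⟩ := exists_algebraMap_splitTrace_one_eq (Localization.AtPrime P) h ε
  rw [Algebra.linearMap_apply, map_prod]
  exact Finset.prod_eq_zero (Finset.mem_range.2 hi) (by rw [map_sub, map_natCast, h1, sub_self])

/-- Evaluate the polynomial `∏ (i - X)`, `1 ≤ i ≤ N`, at `0` and at its root `splitTrace s p 1`. -/
theorem splitTrace_one_dvd_factorial {s : B →ₗ[R] F} {p : F →ₗ[R] B}
    (h : p ∘ₗ s = LinearMap.id) (ε : B →ₐ[R] R) :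
    splitTrace s p 1 ∣ ((Module.finrank R F).factorial : R) := by
  let Q : Polynomial R :=
    ∏ i ∈ Finset.range (Module.finrank R F), (((i + 1 : ℕ) : Polynomial R) - Polynomial.X)
  have h1 := Polynomial.sub_dvd_eval_sub 0 (splitTrace s p 1) Q
  have h2 : Q.eval (splitTrace s p 1) = 0 := by
    simpa [Q, Polynomial.eval_prod] using prod_sub_splitTrace_one h ε
  have h3 : Q.eval 0 = ((Module.finrank R F).factorial : R) := by
    rw [← Finset.prod_range_add_one_eq_factorial, Nat.cast_prod]
    simp [Q, Polynomial.eval_prod]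
  rwa [h2, h3, sub_zero, zero_sub, neg_dvd] at h1

end Rank

/-! ### The trace is an invariant functional -/

section Integral

open LinearMap TensorProduct Coalgebra HopfAlgebra

variable (k A : Type*) [CommRing k] [CommRing A] [HopfAlgebra k A]

/-- The `A`-algebra endomorphism `a ⊗ b ↦ (a ⊗ 1) Δ(b)` of `A ⊗ A`. Geometrically, it is the
endomorphism `(g, h) ↦ (g, gh)` of the scheme `G × G` over the first factor. -/
def shear : A ⊗[k] A →ₐ[A] A ⊗[k] A :=
  Algebra.TensorProduct.lift (Algebra.ofId A (A ⊗[k] A)) (Bialgebra.comulAlgHom k A)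
    fun _ _ => Commute.all _ _

variable {k A}

theorem shear_one_tmul (b : A) : shear k A (1 ⊗ₜ[k] b) = comul (R := k) b := by
  simp [shear, ← Algebra.TensorProduct.one_def]

theorem shear_apply (x : A ⊗[k] A) : shear k A x = (LinearMap.mul' k A).rTensor A
    ((TensorProduct.assoc k A A A).symm ((comul (R := k)).lTensor A x)) := by
  induction x with
  | zero => simp
  | add x y hx hy => simp only [map_add, hx, hy]
  | tmul a b =>
    have h (y : A ⊗[k] A) : (a ⊗ₜ[k] (1 : A)) * y = (LinearMap.mul' k A).rTensor A
        ((TensorProduct.assoc k A A A).symm (a ⊗ₜ[k] y)) := by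
      induction y with
      | zero => simp
      | add x y hx hy => simp only [mul_add, map_add, tmul_add, hx, hy]
      | tmul c d => simp
    simp [shear, ← h, Algebra.ofId_apply]

/-- The preimage of `1 ⊗ b` under the shear map is `(S ⊗ 1) Δ(b)`, by the antipode axiom. -/
theorem shear_rTensor_antipode_comul (b : A) :
    shear k A ((antipode k).rTensor A (comul (R := k) b)) = 1 ⊗ₜ[k] b := by
  have h1 : (TensorProduct.assoc k A A A).symm.toLinearMap ∘ₗ
      (antipode k (A := A)).rTensor (A ⊗[k] A) =
      ((antipode k).rTensor A).rTensor A ∘ₗ (TensorProduct.assoc k A A A).symm.toLinearMap := by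
    ext; simp
  have h2 : (comul (R := k)).lTensor A ((antipode k).rTensor A (comul (R := k) b)) =
      (antipode k).rTensor (A ⊗[k] A) ((comul (R := k)).lTensor A (comul (R := k) b)) := by
    rw [← LinearMap.comp_apply, lTensor_comp_rTensor, ← rTensor_comp_lTensor, LinearMap.comp_apply]
  have h3 := LinearMap.congr_fun h1 ((comul (R := k)).lTensor A (comul (R := k) b))
  simp only [LinearMap.comp_apply, LinearEquiv.coe_coe, coassoc_symm_apply] at h3
  rw [shear_apply, h2, h3, ← LinearMap.comp_apply, ← LinearMap.comp_apply, ← rTensor_comp,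
    ← rTensor_comp, LinearMap.comp_assoc, mul_antipode_rTensor_comul, rTensor_comp,
    LinearMap.comp_apply, rTensor_counit_comul]
  simp

variable [Module.Finite k A]

/-- Surjectivity of the shear map suffices, since `A ⊗ A` is a finite `A`-module. -/
theorem shear_bijective : Function.Bijective (shear k A) := by
  have hsurj : Function.Surjective (shear k A) := by
    rw [← AlgHom.range_eq_top, eq_top_iff]
    rintro x -
    induction x with
    | zero => exact zero_mem _
    | add x y hx hy => exact add_mem hx hy
    | tmul a b =>
      have h : a ⊗ₜ[k] b = a • (1 : A) ⊗ₜ[k] b := by simp [TensorProduct.smul_tmul']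
      rw [h]
      exact Subalgebra.smul_mem _ ((AlgHom.mem_range _).2 ⟨_, shear_rTensor_antipode_comul b⟩) a
  exact ⟨OrzechProperty.injective_of_surjective_endomorphism (shear k A).toLinearMap hsurj, hsurj⟩

/-- The shear map carries multiplication by `1 ⊗ a` to multiplication by `Δ(a)`, so that these have
the same trace over `A`. -/
theorem lTensor_splitTrace_comul {F : Type*} [AddCommGroup F] [Module k F] [Module.Free k F]
    [Module.Finite k F] {s : A →ₗ[k] F} {p : F →ₗ[k] A} (h : p ∘ₗ s = LinearMap.id) (a : A) :
    (splitTrace s p).lTensor A (comul (R := k) a) = 1 ⊗ₜ[k] splitTrace s p a := by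
  have hb : p.baseChange A ∘ₗ s.baseChange A = LinearMap.id := by
    rw [← LinearMap.baseChange_comp, h, LinearMap.baseChange_id]
  have h1 := splitTrace_algEquiv hb (AlgEquiv.ofBijective _ shear_bijective) (1 ⊗ₜ[k] a)
  rw [AlgEquiv.coe_ofBijective, shear_one_tmul, splitTrace_baseChange, splitTrace_baseChange] at h1
  exact (TensorProduct.rid k A).injective h1

end Integral

/-! ### Averaging over `G` -/

namespace GModule

variable {k : Type u} [CommRing k] {A : Type u} [CommRing A] [HopfAlgebra k A]

/-- The map `M → M` contracting the coaction with a functional `t` on `k[G]`. -/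
def average (t : A →ₗ[k] k) (M : GModule k A) : M.V →ₗ[k] M.V :=
  (TensorProduct.rid k M.V).toLinearMap ∘ₗ t.lTensor M.V ∘ₗ M.coact

theorem average_naturality (t : A →ₗ[k] k) {M N : GModule k A} (f : M ⟶ N) (x : M.V) :
    average t N (lin f x) = lin f (average t M x) := by
  have h : (TensorProduct.rid k N.V).toLinearMap ∘ₗ t.lTensor N.V ∘ₗ (lin f).rTensor A =
      lin f ∘ₗ (TensorProduct.rid k M.V).toLinearMap ∘ₗ t.lTensor M.V := by
    ext; simp
  have := LinearMap.congr_fun h (M.coact x)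
  simpa only [average, LinearMap.comp_apply, LinearEquiv.coe_coe, comm_apply] using this

theorem average_of_mem_invariants (t : A →ₗ[k] k) {M : GModule k A} {x : M.V}
    (hx : x ∈ invariants M) : average t M x = t 1 • x := by
  rw [mem_invariants] at hx
  simp [average, hx]

theorem average_mem_invariants {t : A →ₗ[k] k}
    (ht : ∀ a, t.lTensor A (Coalgebra.comul (R := k) a) = 1 ⊗ₜ[k] t a)
    {M : GModule k A} (x : M.V) : average t M x ∈ invariants M := by
  rw [mem_invariants]
  have h1 : M.coact ∘ₗ (TensorProduct.rid k M.V).toLinearMap ∘ₗ t.lTensor M.V =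
      (TensorProduct.rid k A).toLinearMap.lTensor M.V ∘ₗ (t.lTensor A).lTensor M.V ∘ₗ
        (TensorProduct.assoc k M.V A A).toLinearMap ∘ₗ M.coact.rTensor A := by
    refine TensorProduct.ext' fun m a => ?_
    simp only [LinearMap.comp_apply, LinearEquiv.coe_coe, LinearMap.lTensor_tmul,
      LinearMap.rTensor_tmul, TensorProduct.rid_tmul, map_smul]
    induction M.coact m with
    | zero => simp
    | add x y hx hy => simp only [smul_add, TensorProduct.add_tmul, map_add, hx, hy]
    | tmul y b => simp
  have h2 : (TensorProduct.rid k A).toLinearMap.lTensor M.V ∘ₗ (t.lTensor A).lTensor M.V ∘ₗ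
      (Coalgebra.comul (R := k)).lTensor M.V =
      (TensorProduct.mk k M.V A).flip 1 ∘ₗ (TensorProduct.rid k M.V).toLinearMap ∘ₗ
        t.lTensor M.V := by
    refine TensorProduct.ext' fun m a => ?_
    simp [ht, TensorProduct.smul_tmul']
  have h3 := LinearMap.congr_fun M.coassoc x
  have h4 := LinearMap.congr_fun h1 (M.coact x)
  have h5 := LinearMap.congr_fun h2 (M.coact x)
  simp only [LinearMap.comp_apply, LinearEquiv.coe_coe] at h3 h4 h5
  rw [h3] at h4
  exact h4.trans h5

/-! ### Derived functors of the invariants -/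

/-- The functor forgetting the coaction. -/
def forgetFunctor (k : Type u) [CommRing k] (A : Type u) [CommRing A] [HopfAlgebra k A] :
    GModule k A ⥤ ModuleCat.{u} k where
  obj M := ModuleCat.of k M.V
  map f := ModuleCat.ofHom (lin f)

instance : (forgetFunctor k A).Additive where

/-- The inclusion `M^G → M`, as a natural transformation. -/
def invariantsInclusion : invariantsFunctor k A ⟶ forgetFunctor k A where
  app M := ModuleCat.ofHom (invariants M).subtype
  naturality _ _ _ := rfl

/-- The map `M → M^G`, `x ↦ c • average t M x`, for an invariant functional `t`. -/
def averageNatTrans (t : A →ₗ[k] k)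
    (ht : ∀ a, t.lTensor A (Coalgebra.comul (R := k) a) = 1 ⊗ₜ[k] t a) (c : k) :
    forgetFunctor k A ⟶ invariantsFunctor k A where
  app M := ModuleCat.ofHom (c • (average t M).codRestrict _ (average_mem_invariants ht))
  naturality M N f := by
    ext x
    exact Subtype.ext ((congrArg (c • ·) (average_naturality t f x)).trans
      ((lin f).map_smul c _).symm)

theorem invariantsInclusion_comp_averageNatTrans {t : A →ₗ[k] k}
    (ht : ∀ a, t.lTensor A (Coalgebra.comul (R := k) a) = 1 ⊗ₜ[k] t a) {c : k} {n : ℕ}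
    (hn : (n : k) = t 1 * c) :
    invariantsInclusion ≫ averageNatTrans t ht c = n • 𝟙 (invariantsFunctor k A) := by
  ext M x
  refine Subtype.ext ?_
  change c • average t M x.1 = _
  rw [average_of_mem_invariants t x.2, smul_smul, mul_comm, ← hn, Nat.cast_smul_eq_nsmul]
  simp
  rfl

variable [Module.Flat k A]

theorem ker_le_range_of_exact {S : ShortComplex (GModule k A)} (hS : S.Exact) :
    LinearMap.ker (lin S.g) ≤ LinearMap.range (lin S.f) := by
  intro x hx
  obtain ⟨T, π, _, y, hy⟩ :=
    (S.exact_iff_exact_up_to_refinements.1 hS) (kerι S.g) (kerι_comp S.g)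
  obtain ⟨z, hz⟩ := surjective_of_epi π ⟨x, hx⟩
  refine ⟨lin y z, ?_⟩
  have := LinearMap.congr_fun (congrArg lin hy) z
  simp only [comp_lin, LinearMap.comp_apply, hz] at this
  exact this.symm

/-- Exactness of `G`-modules is exactness of the underlying `k`-modules. -/
instance : (forgetFunctor k A).PreservesHomology :=
  Functor.preservesHomology_of_map_exact _ fun S hS => by
    rw [ShortComplex.moduleCat_exact_iff]
    exact fun x hx => ker_le_range_of_exact hS hx

theorem isZero_rightDerived_forgetFunctor {i : ℕ} (hi : 0 < i) (M : GModule k A) :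
    IsZero (((forgetFunctor k A).rightDerived i).obj M) := by
  let I := injectiveResolution M
  refine IsZero.of_iso ?_ (I.isoRightDerivedObj (forgetFunctor k A) i)
  obtain ⟨j, rfl⟩ := Nat.exists_eq_succ_of_ne_zero hi.ne'
  have h : (((forgetFunctor k A).mapHomologicalComplex (ComplexShape.up ℕ)).obj
      I.cocomplex).ExactAt (j + 1) := (I.cocomplex_exactAt_succ j).map (forgetFunctor k A)
  exact h.isZero_homology

theorem rightDerived_nsmul_id (n i : ℕ) (M : GModule k A) :
    (NatTrans.rightDerived (n • 𝟙 (invariantsFunctor k A)) i).app M =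
      n • 𝟙 (cohomology i M) := by
  let I := injectiveResolution M
  have h : (NatTrans.mapHomologicalComplex (n • 𝟙 (invariantsFunctor k A))
      (ComplexShape.up ℕ)).app I.cocomplex = n • 𝟙 _ := by
    ext j : 1
    simp
    rfl
  rw [I.rightDerived_app_eq, h, Functor.map_nsmul, CategoryTheory.Functor.map_id]
  simp
  rfl

/-- An integer divisible by the value at `1` of an invariant functional kills the cohomology:
multiplication by it factors through a derived functor of the exact functor `forgetFunctor`. -/
theorem nsmul_cohomology_eq_zero {t : A →ₗ[k] k}
    (ht : ∀ a, t.lTensor A (Coalgebra.comul (R := k) a) = 1 ⊗ₜ[k] t a) {n : ℕ}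
    (hn : t 1 ∣ (n : k)) {i : ℕ} (hi : 0 < i) (M : GModule k A) (x : cohomology i M) :
    n • x = 0 := by
  obtain ⟨c, hc⟩ := hn
  have h : n • 𝟙 (cohomology i M) = 0 := by
    rw [← rightDerived_nsmul_id, ← invariantsInclusion_comp_averageNatTrans ht hc,
      NatTrans.rightDerived_comp, NatTrans.comp_app]
    rw [(isZero_rightDerived_forgetFunctor hi M).eq_of_tgt
      ((NatTrans.rightDerived invariantsInclusion i).app M) 0, zero_comp]
    rfl
  simpa using congrArg (fun f => f.hom x) h

end GModule

end

theorem mainTheorem2 (k : Type u) [CommRing k] [IsNoetherianRing k]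
    (A : Type u) [CommRing A] [HopfAlgebra k A] [Module.Finite k A] [Module.Flat k A] :
    ∃ n : ℕ, 0 < n ∧ ∀ i : ℕ, 0 < i → ∀ (M : GModule k A) (x : GModule.cohomology i M),
      n • x = 0 := by
  have : Module.FinitePresentation k A := Module.finitePresentation_of_finite k A
  have : Module.Projective k A := Module.Flat.projective_of_finitePresentation
  obtain ⟨m, p, s, -, -, h⟩ := Module.Finite.exists_comp_eq_id_of_projective k A
  exact ⟨_, Nat.factorial_pos _, fun i hi M x =>
    GModule.nsmul_cohomology_eq_zero (lTensor_splitTrace_comul h)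
      (splitTrace_one_dvd_factorial h (Bialgebra.counitAlgHom k A)) hi M x⟩
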